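/- Let $\mathbb T^2=(\mathbb R/\mathbb Z)^2$ with normalized Haar measure, and let $\hat f(n)=\int_{\mathbb T^2}f(x)e^{-2\pi i n\cdot x}\,dx$, $n\in\mathbb Z^2$, denote Fourier coefficients; write $|n|=(n_1^2+n_2^2)^{1/2}$. The Riesz transforms act on periodic distributions by $\widehat{R_jf}(n)=\frac{n_j}{|n|}\hat f(n)$ for $n\neq 0$ and $\widehat{R_jf}(0)=0$. Put $$\|f\|_{\dot H^{-1}(\mathbb T^2)}=\Big(\sum_{n\in\mathbb Z^2\setminus\{0\}}\frac{|\hat f(n)|^2}{|n|^2}\Big)^{1/2},$$ and say that $f\in\dot H^{-1}(\mathbb T^2)$ if this sum is finite (the mean of $f$ is disregarded). There is an absolute constant $C$ such that, for every $f\in L^1(\mathbb T^2;\mathbb C)$ for which the distribution $R_1R_2f$ belongs to $L^1(\mathbb T^2;\mathbb C)$, one has $f\in\dot H^{-1}(\mathbb T^2)$ and $$\|f\|_{\dot H^{-1}(\mathbb T^2)}\le C\big(\|f\|_{L^1(\mathbb T^2)}+\|R_1R_2f\|_{L^1(\mathbb T^2)}\big).$$ -/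

import Mathlib

open MeasureTheory

noncomputable section

/-- The two-dimensional torus `𝕋² = (ℝ/ℤ)²`. -/
abbrev Torus2 : Type := UnitAddTorus (Fin 2)

/-- Normalized Haar measure on `𝕋²`, the measure with respect to which Mathlib's Fourier
coefficients `UnitAddTorus.mFourierCoeff` are taken (see `mFourierCoeff_eq_integral_torusMeasure`). -/
def torusMeasure : Measure Torus2 :=
  Measure.pi fun _ : Fin 2 => (AddCircle.haarAddCircle : Measure UnitAddCircle)

/-- The Fourier coefficients used below are `∫ exp(-2πi n·x) f(x) dx` for `torusMeasure`. -/
theorem mFourierCoeff_eq_integral_torusMeasure (f : Torus2 → ℂ) (n : Fin 2 → ℤ) :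
    UnitAddTorus.mFourierCoeff f n =
      ∫ x, UnitAddTorus.mFourier (-n) x * f x ∂torusMeasure := rfl

/-- The Euclidean length `|n|` of a frequency `n ∈ ℤ²`. -/
def freqNorm (n : Fin 2 → ℤ) : ℝ := Real.sqrt ((n 0 : ℝ) ^ 2 + (n 1 : ℝ) ^ 2)

/-- The Riesz transform `R_j` as a Fourier multiplier, acting on a periodic distribution given by
its family `u` of Fourier coefficients: `(R_j u)^(n) = (n_j / |n|) û(n)` for `n ≠ 0`, and
`(R_j u)^(0) = 0`. -/
def riesz (j : Fin 2) (u : (Fin 2 → ℤ) → ℂ) : (Fin 2 → ℤ) → ℂ :=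
  fun n => if n = 0 then 0 else (((n j : ℝ) / freqNorm n : ℝ) : ℂ) * u n

/-- `h` is an integrable function which represents the distribution `R₁R₂ f`, that is, the
distribution `R₁R₂ f` belongs to `L¹(𝕋²)` and is (almost everywhere) equal to `h`. -/
def IsRieszR1R2 (f h : Torus2 → ℂ) : Prop :=
  Integrable h torusMeasure ∧
    UnitAddTorus.mFourierCoeff h = riesz 0 (riesz 1 (UnitAddTorus.mFourierCoeff f))

/-- The terms `|f̂(n)|² / |n|²`, `n ≠ 0`, of the square of the homogeneous `Ḣ⁻¹` norm. -/
def hdotNegOneTerm (f : Torus2 → ℂ) (n : {n : Fin 2 → ℤ // n ≠ 0}) : ℝ :=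
  ‖UnitAddTorus.mFourierCoeff f n.1‖ ^ 2 / freqNorm n.1 ^ 2

/-- Membership in the homogeneous Sobolev space `Ḣ⁻¹(𝕋²)` (the mean is disregarded). -/
def MemHdotNegOne (f : Torus2 → ℂ) : Prop := Summable (hdotNegOneTerm f)

/-- The homogeneous norm `‖f‖_{Ḣ⁻¹} = (∑_{n ≠ 0} |n|⁻² |f̂(n)|²)^{1/2}`; it is meaningful for `f`
with `MemHdotNegOne f`. -/
def hdotNegOneNorm (f : Torus2 → ℂ) : ℝ := Real.sqrt (∑' n, hdotNegOneTerm f n)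

end

open UnitAddTorus ComplexConjugate Filter Topology

/-! Off the axes, `R₁R₂` has symbol `n₁n₂/|n|²`, so with `h = R₁R₂f` one has `|f̂|²/|n|² = ĥ · conj
f̂ / (n₁n₂)`. The weights `1/(n₁n₂)` are the Fourier coefficients of a product of two sawtooth
functions, a bounded kernel; pairing it with `h` and `f` bounds the off-axis sum by `π²‖h‖₁‖f‖₁`
(`sum_offAxisTerm_le`). On the axes `|f̂| ≤ ‖f‖₁` and `∑ 1/k² < ∞` suffice. Abel means make the
kernel series absolutely convergent; positivity of the terms lets `r → 1`. -/

/-- If a family of functions bounded by `1` has a uniformly bounded weighted sum, then so has the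
family of its integrals against an integrable function. -/
theorem norm_tsum_mul_integral_le {ι X : Type*} [Countable ι] [MeasurableSpace X] {μ : Measure X}
    {w : ι → ℂ} {φ : ι → X → ℂ} {g : X → ℂ} {B : ℝ} (hw : Summable fun i => ‖w i‖)
    (hφm : ∀ i, AEStronglyMeasurable (φ i) μ) (hφ : ∀ i y, ‖φ i y‖ ≤ 1)
    (hB : ∀ y, ‖∑' i, w i * φ i y‖ ≤ B) (hg : Integrable g μ) :
    ‖∑' i, w i * ∫ y, φ i y * g y ∂μ‖ ≤ B * ∫ y, ‖g y‖ ∂μ := by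
  have hφg (i : ι) : Integrable (fun y => φ i y * g y) μ :=
    hg.bdd_mul (hφm i) (Eventually.of_forall (hφ i))
  have hle (i : ι) : ∫ y, ‖w i * (φ i y * g y)‖ ∂μ ≤ ‖w i‖ * ∫ y, ‖g y‖ ∂μ := by
    rw [← integral_const_mul]
    refine integral_mono ((hφg i).const_mul _).norm (hg.norm.const_mul _) fun y => ?_
    simp only [norm_mul]
    gcongr
    exact mul_le_of_le_one_left (norm_nonneg _) (hφ i y)
  have hs : Summable fun i => ∫ y, ‖w i * (φ i y * g y)‖ ∂μ :=
    (hw.mul_right _).of_nonneg_of_le (fun i => integral_nonneg fun y => norm_nonneg _) hle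
  have key := hasSum_integral_of_summable_integral_norm (fun i => (hφg i).const_mul (w i)) hs
  simp only [integral_const_mul] at key
  rw [key.tsum_eq, ← integral_const_mul]
  refine norm_integral_le_of_norm_le (hg.norm.const_mul _) (Eventually.of_forall fun y => ?_)
  simp only [← mul_assoc, tsum_mul_right, norm_mul]
  gcongr
  exact hB y

theorem norm_fourier_apply {T : ℝ} (n : ℤ) (x : AddCircle T) : ‖fourier n x‖ = 1 := by
  rw [fourier_apply]
  exact Circle.norm_coe _

theorem norm_mFourier_apply {d : Type*} [Fintype d] (n : d → ℤ) (x : UnitAddTorus d) :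
    ‖mFourier n x‖ = 1 := by
  simp only [mFourier, ContinuousMap.coe_mk, norm_prod, norm_fourier_apply, Finset.prod_const_one]

theorem mFourier_sub_apply {d : Type*} [Fintype d] (n : d → ℤ) (y x : UnitAddTorus d) :
    mFourier n (y - x) = mFourier n y * mFourier (-n) x := by
  simp only [mFourier, ContinuousMap.coe_mk]
  rw [← Finset.prod_mul_distrib]
  refine Finset.prod_congr rfl fun i _ => ?_
  rw [Pi.sub_apply, Pi.neg_apply, fourier_apply, fourier_apply, fourier_apply, sub_eq_add_neg,
    smul_add, AddCircle.toCircle_add, Circle.coe_mul, smul_neg, neg_smul]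

theorem norm_mFourierCoeff_le (f : Torus2 → ℂ) (n : Fin 2 → ℤ) :
    ‖mFourierCoeff f n‖ ≤ ∫ x, ‖f x‖ ∂torusMeasure := by
  rw [mFourierCoeff_eq_integral_torusMeasure]
  refine (norm_integral_le_integral_norm _).trans_eq ?_
  simp [norm_mFourier_apply]

theorem conj_mFourierCoeff (f : Torus2 → ℂ) (n : Fin 2 → ℤ) :
    conj (mFourierCoeff f n) = ∫ x, mFourier n x * conj (f x) ∂torusMeasure := by
  rw [mFourierCoeff_eq_integral_torusMeasure, ← integral_conj]
  simp [mFourier_neg]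

/-- A bounded kernel with absolutely summable Fourier coefficients defines a bounded sesquilinear
form on `L¹(𝕋²)`. -/
theorem norm_tsum_mFourierCoeff_mul_conj_le {w : (Fin 2 → ℤ) → ℂ} {B : ℝ}
    (hw : Summable fun n => ‖w n‖) (hB : ∀ x : Torus2, ‖∑' n, w n * mFourier n x‖ ≤ B)
    {f g : Torus2 → ℂ} (hf : Integrable f torusMeasure) (hg : Integrable g torusMeasure) :
    Summable (fun n => ‖w n * mFourierCoeff g n * conj (mFourierCoeff f n)‖) ∧
      ‖∑' n, w n * mFourierCoeff g n * conj (mFourierCoeff f n)‖ ≤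
        B * (∫ x, ‖g x‖ ∂torusMeasure) * ∫ x, ‖f x‖ ∂torusMeasure := by
  have hwg : Summable fun n => ‖w n * mFourierCoeff g n‖ := by
    refine (hw.mul_right (∫ x, ‖g x‖ ∂torusMeasure)).of_nonneg_of_le
      (fun n => norm_nonneg _) fun n => ?_
    rw [norm_mul]
    gcongr
    exact norm_mFourierCoeff_le g n
  constructor
  · refine (hwg.mul_right (∫ x, ‖f x‖ ∂torusMeasure)).of_nonneg_of_le
      (fun n => norm_nonneg _) fun n => ?_
    rw [norm_mul _ (conj _), RCLike.norm_conj]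
    gcongr
    exact norm_mFourierCoeff_le f n
  · simp only [conj_mFourierCoeff]
    have hfc : Integrable (fun x => conj (f x)) torusMeasure :=
      (RCLike.conjCLE (K := ℂ)).toContinuousLinearMap.integrable_comp hf
    refine (norm_tsum_mul_integral_le (B := B * ∫ x, ‖g x‖ ∂torusMeasure) hwg
      (fun n => (mFourier n).continuous.aestronglyMeasurable)
      (fun n y => (norm_mFourier_apply n y).le) (fun y => ?_) hfc).trans_eq (by simp)
    -- For fixed `y` the sum is the convolution of the kernel with `g` at `y`, and translates of the
    -- kernel obey the same bound `B`.
    have h := norm_tsum_mul_integral_le (μ := torusMeasure) (B := B) (g := g) (w := w)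
      (φ := fun n x => mFourier n y * mFourier (-n) x) hw
      (fun n => by fun_prop) (fun n x => by simp [norm_mFourier_apply])
      (fun x => by
        convert hB (y - x) using 4 with n
        exact congrArg (w n * ·) (mFourier_sub_apply n y x).symm) hg
    simp only [mul_assoc, integral_const_mul] at h ⊢
    simpa only [mFourierCoeff_eq_integral_torusMeasure, mul_comm (mFourier _ y)] using h

/-! ### The bounded sawtooth kernel -/

/-- The Abel means `r^|k| / k` of the Fourier coefficients of the sawtooth function. -/
noncomputable def abelSawtoothCoeff (r : ℝ) (k : ℤ) : ℝ := r ^ k.natAbs / k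

theorem fourier_natCast_apply {T : ℝ} (k : ℕ) (x : AddCircle T) :
    (fourier (k : ℤ) x : ℂ) = fourier 1 x ^ k := by
  simp [fourier_apply, AddCircle.toCircle_nsmul]

theorem abelSawtoothCoeff_natCast_mul_fourier (r : ℝ) (k : ℕ) (x : UnitAddCircle) :
    (abelSawtoothCoeff r k : ℂ) * fourier (k : ℤ) x = (r * fourier 1 x) ^ k / k := by
  rw [fourier_natCast_apply, mul_pow]
  simp only [abelSawtoothCoeff, Int.natAbs_natCast]
  push_cast
  ring

theorem abelSawtoothCoeff_neg (r : ℝ) (k : ℤ) :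
    abelSawtoothCoeff r (-k) = -abelSawtoothCoeff r k := by
  simp [abelSawtoothCoeff, div_neg]

theorem hasSum_conj_log {z : ℂ} (hz : ‖z‖ < 1) :
    HasSum (fun k : ℕ => -conj (z ^ k / k)) (conj (Complex.log (1 - z))) := by
  have h := (Complex.hasSum_conj'.2 (Complex.hasSum_taylorSeries_neg_log hz)).neg
  simpa only [map_neg, neg_neg] using h

theorem hasSum_abelSawtoothCoeff {r : ℝ} (hr0 : 0 ≤ r) (hr1 : r < 1) (x : UnitAddCircle) :
    HasSum (fun k => (abelSawtoothCoeff r k : ℂ) * fourier k x)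
      (-Complex.log (1 - r * fourier 1 x) + conj (Complex.log (1 - r * fourier 1 x))) := by
  have hz : ‖(r * fourier 1 x : ℂ)‖ < 1 := by
    rwa [norm_mul, norm_fourier_apply, mul_one, Complex.norm_real, Real.norm_of_nonneg hr0]
  have h1 : HasSum (fun k : ℕ => (abelSawtoothCoeff r k : ℂ) * fourier (k : ℤ) x)
      (-Complex.log (1 - r * fourier 1 x)) := by
    simpa only [abelSawtoothCoeff_natCast_mul_fourier] using
      Complex.hasSum_taylorSeries_neg_log hz
  have h2 : HasSum (fun k : ℕ => (abelSawtoothCoeff r (-k) : ℂ) * fourier (-k : ℤ) x)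
      (conj (Complex.log (1 - r * fourier 1 x))) := by
    refine (hasSum_conj_log hz).congr_fun fun k => ?_
    rw [← abelSawtoothCoeff_natCast_mul_fourier, abelSawtoothCoeff_neg, fourier_neg, map_mul,
      Complex.conj_ofReal, Complex.ofReal_neg, neg_mul]
  -- The two half-sums both count `k = 0`, harmlessly since `r ^ 0 / 0 = 0`.
  have h0 : (abelSawtoothCoeff r 0 : ℂ) * fourier 0 x = 0 := by
    rw [abelSawtoothCoeff, Int.cast_zero, div_zero, Complex.ofReal_zero, zero_mul]
  have h3 := HasSum.of_nat_of_neg (f := fun k => (abelSawtoothCoeff r k : ℂ) * fourier k x) h1 h2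
  rwa [h0, sub_zero] at h3

/-- The sum equals `-2i arg (1 - z)` with `z = r * fourier 1 x`; as `1 - z` lies in the right
half-plane, its argument is at most `π/2` in modulus, uniformly in `r`. -/
theorem norm_tsum_abelSawtoothCoeff_le {r : ℝ} (hr0 : 0 ≤ r) (hr1 : r < 1) (x : UnitAddCircle) :
    ‖∑' k, (abelSawtoothCoeff r k : ℂ) * fourier k x‖ ≤ Real.pi := by
  rw [(hasSum_abelSawtoothCoeff hr0 hr1 x).tsum_eq]
  set z : ℂ := r * fourier 1 x with hz
  have hz1 : ‖z‖ < 1 := by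
    rwa [hz, norm_mul, norm_fourier_apply, mul_one, Complex.norm_real, Real.norm_of_nonneg hr0]
  have hre : 0 ≤ (1 - z).re := by
    have := (Complex.abs_re_le_norm z).trans_lt hz1
    simpa using (abs_lt.1 this).2.le
  have harg := Complex.abs_arg_le_pi_div_two_iff.2 hre
  have : -Complex.log (1 - z) + conj (Complex.log (1 - z))
      = ((-2 * (1 - z).arg : ℝ) : ℂ) * Complex.I := by
    apply Complex.ext <;> simp [Complex.log_im]
    ring
  rw [this, norm_mul, Complex.norm_I, mul_one, Complex.norm_real, Real.norm_eq_abs, abs_mul]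
  norm_num
  linarith

theorem summable_norm_abelSawtoothCoeff {r : ℝ} (hr0 : 0 ≤ r) (hr1 : r < 1) :
    Summable fun k => ‖(abelSawtoothCoeff r k : ℂ)‖ := by
  have h (k : ℕ) : ‖r ^ k / k‖ ≤ r ^ k := by
    rw [norm_div, Real.norm_of_nonneg (pow_nonneg hr0 k), Real.norm_natCast]
    rcases Nat.eq_zero_or_pos k with rfl | hk
    · simp
    · exact div_le_self (pow_nonneg hr0 k) (by exact_mod_cast hk)
  have hs := (summable_geometric_of_lt_one hr0 hr1).of_nonneg_of_le (fun k => norm_nonneg _) h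
  refine Summable.of_nat_of_neg (hs.congr fun k => ?_) (hs.congr fun k => ?_) <;>
    simp [abelSawtoothCoeff]

theorem summable_mul_fin_two {R : Type*} [NormedRing R] [CompleteSpace R] {a b : ℤ → R}
    (ha : Summable fun k => ‖a k‖) (hb : Summable fun k => ‖b k‖) :
    Summable fun n : Fin 2 → ℤ => ‖a (n 0) * b (n 1)‖ :=
  (ha.mul_norm hb).comp_injective (i := fun n : Fin 2 → ℤ => (n 0, n 1)) (finTwoArrowEquiv ℤ).injective

theorem norm_tsum_abelSawtoothCoeff_mul_le {r : ℝ} (hr0 : 0 ≤ r) (hr1 : r < 1) (x : Torus2) :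
    ‖∑' n : Fin 2 → ℤ, ((abelSawtoothCoeff r (n 0) : ℂ) * abelSawtoothCoeff r (n 1)) *
      mFourier n x‖ ≤ Real.pi ^ 2 := by
  have hs (y : UnitAddCircle) : Summable fun k => ‖(abelSawtoothCoeff r k : ℂ) * fourier k y‖ := by
    simpa only [norm_mul, norm_fourier_apply, mul_one] using summable_norm_abelSawtoothCoeff hr0 hr1
  have h := tsum_mul_tsum_of_summable_norm (hs (x 0)) (hs (x 1))
  rw [← (finTwoArrowEquiv ℤ).tsum_eq] at h
  have h' : ∑' n : Fin 2 → ℤ, ((abelSawtoothCoeff r (n 0) : ℂ) * abelSawtoothCoeff r (n 1)) *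
      mFourier n x = (∑' k, (abelSawtoothCoeff r k : ℂ) * fourier k (x 0)) *
        ∑' k, (abelSawtoothCoeff r k : ℂ) * fourier k (x 1) := by
    rw [h]
    refine tsum_congr fun n => ?_
    simp only [mFourier, ContinuousMap.coe_mk, Fin.prod_univ_two]
    exact mul_mul_mul_comm _ _ _ _
  rw [h', norm_mul, sq]
  exact mul_le_mul (norm_tsum_abelSawtoothCoeff_le hr0 hr1 _)
    (norm_tsum_abelSawtoothCoeff_le hr0 hr1 _) (norm_nonneg _) Real.pi_pos.le

/-! ### Frequencies off the axes -/

/-- The part of the `Ḣ⁻¹` series away from the coordinate axes. -/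
noncomputable def offAxisTerm (f : Torus2 → ℂ) (n : Fin 2 → ℤ) : ℝ :=
  if n 0 = 0 ∨ n 1 = 0 then 0 else ‖mFourierCoeff f n‖ ^ 2 / freqNorm n ^ 2

theorem offAxisTerm_nonneg (f : Torus2 → ℂ) (n : Fin 2 → ℤ) : 0 ≤ offAxisTerm f n := by
  unfold offAxisTerm
  split_ifs <;> positivity

/-- The factors `n₁n₂` cancel. On the axes both sides vanish, because division by zero gives `0` in
the sawtooth coefficient. -/
theorem abelSawtoothCoeff_mul_riesz (r : ℝ) {f h : Torus2 → ℂ} (hfh : IsRieszR1R2 f h)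
    (n : Fin 2 → ℤ) :
    ((abelSawtoothCoeff r (n 0) : ℂ) * abelSawtoothCoeff r (n 1)) * mFourierCoeff h n *
      conj (mFourierCoeff f n) =
        ((r ^ (n 0).natAbs * r ^ (n 1).natAbs * offAxisTerm f n : ℝ) : ℂ) := by
  rw [hfh.2]
  by_cases h0 : n 0 = 0
  · simp [abelSawtoothCoeff, offAxisTerm, h0]
  by_cases h1 : n 1 = 0
  · simp [abelSawtoothCoeff, offAxisTerm, h1]
  have hn : n ≠ 0 := fun h => h0 (by simp [h])
  have h0' : (n 0 : ℂ) ≠ 0 := by exact_mod_cast h0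
  have h1' : (n 1 : ℂ) ≠ 0 := by exact_mod_cast h1
  have hmul := Complex.mul_conj' (mFourierCoeff f n)
  simp only [abelSawtoothCoeff, offAxisTerm, h0, h1, riesz, hn, or_self, if_false]
  push_cast
  rw [← hmul]
  field_simp

theorem sum_offAxisTerm_le {f h : Torus2 → ℂ} (hf : Integrable f torusMeasure)
    (hfh : IsRieszR1R2 f h) (s : Finset (Fin 2 → ℤ)) :
    ∑ n ∈ s, offAxisTerm f n ≤
      Real.pi ^ 2 * (∫ x, ‖h x‖ ∂torusMeasure) * ∫ x, ‖f x‖ ∂torusMeasure := by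
  have hlim : Tendsto
      (fun r : ℝ => ∑ n ∈ s, r ^ (n 0).natAbs * r ^ (n 1).natAbs * offAxisTerm f n)
      (𝓝[<] 1) (𝓝 (∑ n ∈ s, offAxisTerm f n)) := by
    have hc : Continuous
        (fun r : ℝ => ∑ n ∈ s, r ^ (n 0).natAbs * r ^ (n 1).natAbs * offAxisTerm f n) := by
      fun_prop
    simpa using (hc.tendsto 1).mono_left nhdsWithin_le_nhds
  -- It is enough to bound the damped finite sums for `0 < r < 1`, uniformly in `r`.
  refine le_of_tendsto hlim ?_
  filter_upwards [Ioo_mem_nhdsLT (show (0 : ℝ) < 1 by norm_num)] with r hr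
  have hw : Summable fun n : Fin 2 → ℤ =>
      ‖(abelSawtoothCoeff r (n 0) : ℂ) * abelSawtoothCoeff r (n 1)‖ :=
    summable_mul_fin_two (a := fun k => (abelSawtoothCoeff r k : ℂ))
      (b := fun k => (abelSawtoothCoeff r k : ℂ)) (summable_norm_abelSawtoothCoeff hr.1.le hr.2)
      (summable_norm_abelSawtoothCoeff hr.1.le hr.2)
  obtain ⟨hs, hle⟩ := norm_tsum_mFourierCoeff_mul_conj_le
    (w := fun n => (abelSawtoothCoeff r (n 0) : ℂ) * abelSawtoothCoeff r (n 1)) hw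
    (norm_tsum_abelSawtoothCoeff_mul_le hr.1.le hr.2) hf hfh.1
  simp only [abelSawtoothCoeff_mul_riesz r hfh] at hs hle
  have hnn (n : Fin 2 → ℤ) : 0 ≤ r ^ (n 0).natAbs * r ^ (n 1).natAbs * offAxisTerm f n :=
    mul_nonneg (mul_nonneg (pow_nonneg hr.1.le _) (pow_nonneg hr.1.le _)) (offAxisTerm_nonneg f n)
  simp only [Complex.norm_real, Real.norm_of_nonneg (hnn _)] at hs
  rw [← Complex.ofReal_tsum, Complex.norm_real, Real.norm_of_nonneg (tsum_nonneg hnn)] at hle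
  exact (hs.sum_le_tsum s fun n _ => hnn n).trans hle

/-! ### Frequencies on the axes, and conclusion -/

/-- A summable majorant of `1 / |n|²` on the coordinate axes. -/
noncomputable def axisWeight (n : Fin 2 → ℤ) : ℝ :=
  1 / (n 0 : ℝ) ^ 2 * (if n 1 = 0 then 1 else 0) + (if n 0 = 0 then 1 else 0) * (1 / (n 1 : ℝ) ^ 2)

theorem axisWeight_nonneg (n : Fin 2 → ℤ) : 0 ≤ axisWeight n := by
  unfold axisWeight
  positivity

theorem summable_axisWeight : Summable axisWeight := by
  have hi : Summable fun k : ℤ => ‖1 / (k : ℝ) ^ 2‖ :=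
    (Real.summable_one_div_int_pow.2 one_lt_two).norm
  have hd : Summable fun k : ℤ => ‖if k = 0 then (1 : ℝ) else 0‖ :=
    summable_of_ne_finset_zero (s := {0}) fun k hk => by simpa using hk
  exact (summable_mul_fin_two hi hd).of_norm.add (summable_mul_fin_two hd hi).of_norm

theorem hdotNegOneTerm_le (f : Torus2 → ℂ) (n : {n : Fin 2 → ℤ // n ≠ 0}) :
    hdotNegOneTerm f n ≤
      offAxisTerm f n + axisWeight n * (∫ x, ‖f x‖ ∂torusMeasure) ^ 2 := by
  obtain ⟨n, hn⟩ := n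
  have hA := mul_nonneg (axisWeight_nonneg n) (sq_nonneg (∫ x, ‖f x‖ ∂torusMeasure))
  by_cases h : n 0 = 0 ∨ n 1 = 0
  · have hnorm : 1 / freqNorm n ^ 2 ≤ axisWeight n := by
      rw [freqNorm, Real.sq_sqrt (by positivity)]
      rcases h with h | h <;> simp [axisWeight, h]
    simp only [hdotNegOneTerm, offAxisTerm, h, if_true, zero_add]
    rw [div_eq_mul_one_div, mul_comm]
    exact mul_le_mul hnorm (pow_le_pow_left₀ (norm_nonneg _) (norm_mFourierCoeff_le f n) 2)
      (by positivity) (axisWeight_nonneg n)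
  · simpa [hdotNegOneTerm, offAxisTerm, h] using hA

theorem corollary2p3 :
    ∃ C : ℝ, ∀ f h : Torus2 → ℂ, Integrable f torusMeasure → IsRieszR1R2 f h →
      MemHdotNegOne f ∧
        hdotNegOneNorm f ≤ C * ((∫ x, ‖f x‖ ∂torusMeasure) + ∫ x, ‖h x‖ ∂torusMeasure) := by
  set A := ∑' n, axisWeight n with hA
  have hA0 : 0 ≤ A := tsum_nonneg axisWeight_nonneg
  refine ⟨Real.sqrt (Real.pi ^ 2 + A), fun f h hf hfh => ?_⟩
  set F := ∫ x, ‖f x‖ ∂torusMeasure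
  set H := ∫ x, ‖h x‖ ∂torusMeasure
  have hF : 0 ≤ F := integral_nonneg fun x => norm_nonneg _
  have hH : 0 ≤ H := integral_nonneg fun x => norm_nonneg _
  have hoff : Summable (offAxisTerm f) :=
    summable_of_sum_le (offAxisTerm_nonneg f) (sum_offAxisTerm_le hf hfh)
  have hmaj : Summable fun n => offAxisTerm f n + axisWeight n * F ^ 2 :=
    hoff.add (summable_axisWeight.mul_right _)
  have hmaj_nonneg (n : Fin 2 → ℤ) : 0 ≤ offAxisTerm f n + axisWeight n * F ^ 2 :=
    add_nonneg (offAxisTerm_nonneg f n) (mul_nonneg (axisWeight_nonneg n) (sq_nonneg F))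
  have hmem : MemHdotNegOne f :=
    (hmaj.subtype {n | n ≠ 0}).of_nonneg_of_le (fun n => by unfold hdotNegOneTerm; positivity)
      (hdotNegOneTerm_le f)
  refine ⟨hmem, ?_⟩
  have hle : ∑' n, hdotNegOneTerm f n ≤ Real.pi ^ 2 * H * F + A * F ^ 2 :=
    calc ∑' n, hdotNegOneTerm f n
        ≤ ∑' n : {n : Fin 2 → ℤ // n ≠ 0}, (offAxisTerm f n + axisWeight n * F ^ 2) :=
          hmem.tsum_le_tsum (hdotNegOneTerm_le f) (hmaj.subtype {n | n ≠ 0})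
      _ ≤ ∑' n, (offAxisTerm f n + axisWeight n * F ^ 2) :=
          hmaj.tsum_subtype_le _ {n | n ≠ 0} hmaj_nonneg
      _ = ∑' n, offAxisTerm f n + A * F ^ 2 := by
          rw [hoff.tsum_add (summable_axisWeight.mul_right _), tsum_mul_right]
      _ ≤ _ := by
          gcongr
          exact hoff.tsum_le_of_sum_le (sum_offAxisTerm_le hf hfh)
  rw [hdotNegOneNorm, ← Real.sqrt_sq (add_nonneg hF hH), ← Real.sqrt_mul (by positivity)]
  refine Real.sqrt_le_sqrt (hle.trans ?_)
  -- `h1` and `h2` add up to the exact slack `(π² + A)(F + H)² - (π²HF + AF²)`.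
  have h1 : 0 ≤ Real.pi ^ 2 * (F ^ 2 + H ^ 2 + F * H) := by positivity
  have h2 : 0 ≤ A * (2 * F * H + H ^ 2) := by positivity
  nlinarith
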